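/- Let $1\le p<\infty$, and let $X$ and $Y$ be Banach spaces over the same scalar field $\mathbb K\in\{\mathbb R,\mathbb C\}$. For a Banach space $Z$ over $\mathbb K$ we use the following terms. A sequence $(z_n^*)_{n}$ in the dual $Z^*$ is weak* $p$-summable if $\sum_n |z_n^*(z)|^p<\infty$ for every $z\in Z$. A set $A\subset Z$ is $p$-limited if for every weak* $p$-summable sequence $(z_n^*)_n$ in $Z^*$ there is a real sequence $(a_n)_n\in\ell_p$ such that $|z_n^*(z)|\le a_n$ for all $z\in A$ and all $n$. The space $Z$ has the weak $p$-GP property if every $p$-limited subset of $Z$ is relatively compact in the norm topology. A bounded linear operator $S:Z\to W$ into a Banach space $W$ is $p$-limited if the image under $S$ of the closed unit ball of $Z$ is a $p$-limited subset of $W$; it is $p$-limited completely continuous ($p$-lcc) if $\|Sz_n\|\to 0$ for every weakly null sequence $(z_n)_n$ in $Z$ such that the set $\{z_n:n\in\mathbb N\}$ is $p$-limited in $Z$. **Theorem 2.4.** Suppose that $Y$ has the weak $p$-GP property. Let $\mathcal M$ be a closed linear subspace of the Banach space $\mathcal L(X,Y)$ of bounded linear operators from $X$ to $Y$ (with the operator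 norm) such that every $T\in\mathcal M$ is a $p$-limited operator and such that, for every $y^*\in Y^*$, the evaluation operator $\psi_{y^*}:\mathcal M\to X^*$, $\psi_{y^*}(T)=T^*y^*=y^*\circ T$, is $p$-lcc. Then the Banach space $\mathcal M$ has the weak $p$-GP property. -/

import Mathlib

open Filter Topology

/-- A sequence `f` in the dual of `X` is weak* `p`-summable if `∑ |f n x| ^ p < ∞`
for every `x`. -/
def WeakStarPSummable {𝕜 X : Type*} [RCLike 𝕜] [NormedAddCommGroup X] [NormedSpace 𝕜 X]
    (p : ℝ) (f : ℕ → StrongDual 𝕜 X) : Prop :=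
  ∀ x : X, Summable fun n => ‖f n x‖ ^ p

/-- A set `A` is `p`-limited if for every weak* `p`-summable sequence `f` in the dual there is
`a ∈ ℓ_p` such that `|f n x| ≤ a n` for all `x ∈ A` and all `n`. -/
def IsPLimited (𝕜 : Type*) {X : Type*} [RCLike 𝕜] [NormedAddCommGroup X] [NormedSpace 𝕜 X]
    (p : ℝ) (A : Set X) : Prop :=
  ∀ f : ℕ → StrongDual 𝕜 X, WeakStarPSummable p f →
    ∃ a : ℕ → ℝ, (Summable fun n => |a n| ^ p) ∧ ∀ x ∈ A, ∀ n, ‖f n x‖ ≤ a n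

/-- `X` has the weak `p`-GP property if every `p`-limited subset of `X` is relatively compact
in norm. -/
def HasWeakPGP (𝕜 X : Type*) [RCLike 𝕜] [NormedAddCommGroup X] [NormedSpace 𝕜 X]
    (p : ℝ) : Prop :=
  ∀ A : Set X, IsPLimited 𝕜 p A → IsCompact (closure A)

/-- A sequence is weakly null if every bounded linear functional maps it to a null sequence. -/
def WeaklyNull (𝕜 : Type*) {X : Type*} [RCLike 𝕜] [NormedAddCommGroup X] [NormedSpace 𝕜 X]
    (x : ℕ → X) : Prop :=
  ∀ f : StrongDual 𝕜 X, Tendsto (fun n => f (x n)) atTop (𝓝 0)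

/-- A bounded operator `T` is `p`-limited completely continuous (`p`-lcc) if `‖T (x n)‖ → 0` for
every weakly null sequence `x` whose range is a `p`-limited set. -/
def IsPLcc {𝕜 X Z : Type*} [RCLike 𝕜] [NormedAddCommGroup X] [NormedSpace 𝕜 X]
    [NormedAddCommGroup Z] [NormedSpace 𝕜 Z] (p : ℝ) (T : X →L[𝕜] Z) : Prop :=
  ∀ x : ℕ → X, IsPLimited 𝕜 p (Set.range x) → WeaklyNull 𝕜 x →
    Tendsto (fun n => ‖T (x n)‖) atTop (𝓝 0)

/-- A bounded operator is `p`-limited if the image of the closed unit ball is `p`-limited. -/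
def IsPLimitedOperator {𝕜 X Y : Type*} [RCLike 𝕜] [NormedAddCommGroup X] [NormedSpace 𝕜 X]
    [NormedAddCommGroup Y] [NormedSpace 𝕜 Y] (p : ℝ) (T : X →L[𝕜] Y) : Prop :=
  IsPLimited 𝕜 p (T '' Metric.closedBall (0 : X) 1)

/-- The evaluation operator `M → X*`, `T ↦ T* y = y ∘ T`, on a subspace `M` of `L(X, Y)`. -/
noncomputable def adjointEval {𝕜 X Y : Type*} [RCLike 𝕜] [NormedAddCommGroup X]
    [NormedSpace 𝕜 X] [NormedAddCommGroup Y] [NormedSpace 𝕜 Y]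
    (M : Submodule 𝕜 (X →L[𝕜] Y)) (y : StrongDual 𝕜 Y) : M →L[𝕜] StrongDual 𝕜 X :=
  (ContinuousLinearMap.compL 𝕜 X Y 𝕜 y).comp M.subtypeL

theorem adjointEval_apply {𝕜 X Y : Type*} [RCLike 𝕜] [NormedAddCommGroup X]
    [NormedSpace 𝕜 X] [NormedAddCommGroup Y] [NormedSpace 𝕜 Y]
    (M : Submodule 𝕜 (X →L[𝕜] Y)) (y : StrongDual 𝕜 Y) (T : M) :
    adjointEval M y T = y.comp (T : X →L[𝕜] Y) :=
  rfl

/-! The key fact is that every sequence in a `p`-limited set `A` has a weakly Cauchy subsequence.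
Being `p`-limited makes the restriction map from functionals to bounded functions on `A`
`p`-summing, so Pietsch domination (`IsPLimited.exists_positive_dominating`) bounds `‖f z‖ ^ p` on
`A` by a positive functional of `|f|^p` on the unit ball. Comparing `p`-th powers with squares turns
this into `‖f z‖ ≤ K √⟨f, f⟩ + δ ‖f‖` with `δ` arbitrarily small. Each evaluation at a point of the
sequence thus splits into a Hilbertian part and a small part. Countably many Hilbertian parts live
in a separable Hilbert space, so one diagonal subsequence serves all `f`.

In `M`, differences along such a subsequence of a `p`-limited set form weakly null `p`-limited
sequences `S n`. For nearly norming unit-ball vectors `x n`, the p-lcc evaluations make `S n (x n)`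
weakly null in `Y`. These vectors also lie in a `p`-limited set, relatively compact by the weak
`p`-GP property. Hence they, and so `S n`, tend to zero in norm. -/

/-! ### Splitting and countable approximation of functionals. -/

/-- A countable family of vectors of a Hilbert space has, up to small errors, only countably many
families of inner products with a fixed vector. -/
theorem exists_seq_inner_approx {H ι : Type*} [NormedAddCommGroup H] [InnerProductSpace ℝ H]
    [CompleteSpace H] [Countable ι] (w : ι → H) :
    ∃ d : ℕ → H, ∀ (x : H), ∀ ε > 0, ∃ k, ∀ i,
      |inner ℝ (w i) x - inner ℝ (w i) (d k)| ≤ ‖w i‖ * ε := by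
  -- The closed span is separable, and projecting `x` onto it leaves every `inner (w i) x`
  -- unchanged.
  set K : Submodule ℝ H := (Submodule.span ℝ (Set.range w)).topologicalClosure with hK
  have hsep : TopologicalSpace.IsSeparable (K : Set H) := by
    rw [hK, Submodule.topologicalClosure_coe]
    exact ((Set.countable_range w).isSeparable.span (R := ℝ)).closure
  have : TopologicalSpace.SeparableSpace K := hsep.separableSpace
  have : CompleteSpace K :=
    (Submodule.isClosed_topologicalClosure _).completeSpace_coe
  have hw : ∀ i, w i ∈ K := fun i =>
    Submodule.le_topologicalClosure _ (Submodule.subset_span ⟨i, rfl⟩)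
  refine ⟨fun k => (TopologicalSpace.denseSeq K k : H), fun x ε hε => ?_⟩
  obtain ⟨k, hk⟩ := (TopologicalSpace.denseRange_denseSeq K).exists_dist_lt
    (K.orthogonalProjectionOnto x) hε
  refine ⟨k, fun i => ?_⟩
  have h1 : inner ℝ (w i) x = inner ℝ (w i) (K.orthogonalProjectionOnto x : H) := by
    have := Submodule.inner_starProjection_left_eq_right K (w i) x
    rwa [Submodule.starProjection_eq_self_iff.mpr (hw i)] at this
  rw [h1, ← inner_sub_right]
  refine (abs_real_inner_le_norm _ _).trans ?_
  gcongr
  rw [dist_eq_norm] at hk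
  exact hk.le

/-- A countable family of linear functionals bounded by multiples of a Hilbertian seminorm has,
up to small errors, only countably many families of values. -/
theorem exists_seq_approx_of_le_sqrt_inner {E ι : Type*} [AddCommGroup E] [Module ℝ E]
    [Countable ι] (c : PreInnerProductSpace.Core ℝ E) (u : ι → E →ₗ[ℝ] ℝ) (C : ι → ℝ)
    (hC : ∀ i, 0 ≤ C i) (hu : ∀ i x, |u i x| ≤ C i * √(c.inner x x)) :
    ∃ β : ℕ → ι → ℝ, (∀ k, ∃ B, ∀ i, |β k i| ≤ C i * B) ∧
      ∀ x, ∀ ε > 0, ∃ k, ∀ i, |u i x - β k i| ≤ C i * ε := by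
  let : SeminormedAddCommGroup E := InnerProductSpace.Core.toSeminormedAddCommGroup (c := c)
  let : InnerProductSpace ℝ E := InnerProductSpace.ofCore c
  have hn : ∀ x : E, ‖x‖ = √(c.inner x x) := fun x => rfl
  let J : E →ₗ[ℝ] UniformSpace.Completion E :=
    (UniformSpace.Completion.toComplₗᵢ (𝕜 := ℝ) (E := E)).toLinearMap
  have hJ : ∀ x, ‖J x‖ = ‖x‖ := fun x => UniformSpace.Completion.norm_coe x
  have hd : DenseRange J := UniformSpace.Completion.denseRange_coe
  have hu' : ∀ i x, ‖u i x‖ ≤ C i * ‖J x‖ := fun i x => by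
    rw [hJ, hn]; exact hu i x
  -- Riesz vectors of the `u i`, extended to the Hilbert completion; the bound `hu'` makes them
  -- factor through `J` even if `J` has a kernel.
  let w : ι → UniformSpace.Completion E := fun i =>
    (InnerProductSpace.toDual ℝ (UniformSpace.Completion E)).symm ((u i).extendOfNorm J)
  have hw : ∀ i x, inner ℝ (w i) (J x) = u i x := fun i x => by
    rw [InnerProductSpace.toDual_symm_apply, LinearMap.extendOfNorm_eq hd ⟨_, hu' i⟩]
  have hwn : ∀ i, ‖w i‖ ≤ C i := fun i => by
    simpa only [w, LinearIsometryEquiv.norm_map] using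
      LinearMap.opNorm_extendOfNorm_le hd (hC i) (hu' i)
  obtain ⟨d, hdd⟩ := exists_seq_inner_approx w
  refine ⟨fun k i => inner ℝ (w i) (d k), fun k => ⟨‖d k‖, fun i => ?_⟩, fun x ε hε => ?_⟩
  · refine (abs_real_inner_le_norm _ _).trans ?_
    gcongr
    exact hwn i
  · obtain ⟨k, hk⟩ := hdd (J x) ε hε
    refine ⟨k, fun i => ?_⟩
    rw [← hw]
    refine (hk i).trans ?_
    gcongr
    exact hwn i

/-- A linear functional dominated by the sum of two seminorms is the sum of two functionals
dominated by the respective seminorms. -/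
theorem exists_add_eq_of_le_seminorm_add {E : Type*} [AddCommGroup E] [Module ℝ E]
    (l : E →ₗ[ℝ] ℝ) (p q : Seminorm ℝ E) (h : ∀ x, l x ≤ p x + q x) :
    ∃ u v : E →ₗ[ℝ] ℝ, l = u + v ∧ (∀ x, |u x| ≤ p x) ∧ ∀ x, |v x| ≤ q x := by
  -- Hahn–Banach on `E × E`: extend `l` from the diagonal under `p x + q y`; the two summands are
  -- the restrictions to the axes.
  let F : E × E →ₗ.[ℝ] ℝ :=
    { domain := LinearMap.range (LinearMap.prod LinearMap.id LinearMap.id : E →ₗ[ℝ] E × E)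
      toFun := l ∘ₗ LinearMap.fst ℝ E E ∘ₗ Submodule.subtype _ }
  obtain ⟨g, hg, hgN⟩ := exists_extension_of_le_sublinear F (fun x => p x.1 + q x.2)
    (fun c hc x => by
      simp [map_smul_eq_mul, abs_of_pos hc, mul_add])
    (fun x y => by
      have := map_add_le_add p x.1 y.1
      have := map_add_le_add q x.2 y.2
      simp only [Prod.fst_add, Prod.snd_add]
      linarith)
    (by
      rintro ⟨_, x, rfl⟩
      exact h x)
  have habs : ∀ (u : E →ₗ[ℝ] ℝ) (r : Seminorm ℝ E), (∀ x, u x ≤ r x) → ∀ x, |u x| ≤ r x := by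
    intro u r hur x
    refine abs_le.2 ⟨?_, hur x⟩
    have := hur (-x)
    rw [map_neg, map_neg_eq_map] at this
    linarith
  refine ⟨g ∘ₗ LinearMap.inl ℝ E E, g ∘ₗ LinearMap.inr ℝ E E, ?_, habs _ _ ?_, habs _ _ ?_⟩
  · ext x
    have h1 := hg ⟨(x, x), x, rfl⟩
    have h2 : (x, x) = LinearMap.inl ℝ E E x + LinearMap.inr ℝ E E x := by simp
    change g (x, x) = l x at h1
    rw [← h1, h2, map_add]
    rfl
  · intro x; simpa using hgN (x, 0)
  · intro x; simpa using hgN (0, x)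

/-- Sequences that are uniform limits of members of a countable family of bounded sequences
become Cauchy along a common subsequence. -/
theorem exists_subseq_cauchySeq_of_approx {α ι : Type*} [Countable ι] (a : α → ℕ → ℝ)
    (b : ι → ℕ → ℝ) (hb : ∀ i, ∃ B, ∀ n, |b i n| ≤ B)
    (h : ∀ x, ∀ ε > 0, ∃ i, ∀ n, |a x n - b i n| ≤ ε) :
    ∃ φ : ℕ → ℕ, StrictMono φ ∧ ∀ x, CauchySeq (a x ∘ φ) := by
  choose B hB using hb
  -- Compactness of a countable product of intervals replaces a diagonal extraction.
  obtain ⟨t, -, φ, hφ, ht⟩ := (isCompact_univ_pi fun i => isCompact_Icc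
    (a := -B i) (b := B i)).tendsto_subseq (x := fun n i => b i n)
    (fun n i _ => abs_le.1 (hB i n))
  refine ⟨φ, hφ, fun x => Metric.cauchySeq_iff'.2 fun ε hε => ?_⟩
  obtain ⟨i, hi⟩ := h x (ε / 4) (by positivity)
  have hc := ((tendsto_pi_nhds.1 ht i).cauchySeq)
  obtain ⟨N, hN⟩ := Metric.cauchySeq_iff'.1 hc (ε / 4) (by positivity)
  refine ⟨N, fun n hn => ?_⟩
  have h1 := hN n hn
  have h2 := abs_le.1 (hi (φ n))
  have h3 := abs_le.1 (hi (φ N))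
  simp only [Function.comp, Real.dist_eq] at h1 ⊢
  have h4 := abs_lt.1 h1
  exact abs_lt.2 ⟨by linarith [h2.1, h3.2, h4.1], by linarith [h2.2, h3.1, h4.2]⟩

/-! ### The `p`-summing inequality and Pietsch domination. -/

section PLimited

variable {𝕜 Z : Type*} [RCLike 𝕜] [NormedAddCommGroup Z] [NormedSpace 𝕜 Z] {p : ℝ} {A B : Set Z}

theorem IsPLimited.mono (hB : IsPLimited 𝕜 p B) (h : A ⊆ B) : IsPLimited 𝕜 p A := fun f hf =>
  let ⟨a, ha, hb⟩ := hB f hf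
  ⟨a, ha, fun x hx => hb x (h hx)⟩

/-- The defining property of `p`-limited sets for families over any countable index type. -/
theorem IsPLimited.exists_summable_bound {ι : Type*} [Countable ι] (hA : IsPLimited 𝕜 p A)
    (hp : 0 < p) (f : ι → StrongDual 𝕜 Z) (hf : ∀ x, Summable fun i => ‖f i x‖ ^ p) :
    ∃ a : ι → ℝ, (Summable fun i => |a i| ^ p) ∧ ∀ x ∈ A, ∀ i, ‖f i x‖ ≤ a i := by
  obtain ⟨e, he⟩ := exists_injective_nat ι
  obtain ⟨a, ha, hb⟩ := hA (Function.extend e f 0) (fun x => by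
    rw [← he.summable_iff]
    · simpa only [Function.comp_def, he.extend_apply] using hf x
    · intro k hk
      rw [Function.extend_apply' _ _ _ hk]
      simp [Real.zero_rpow hp.ne'])
  refine ⟨a ∘ e, ha.comp_injective he, fun x hx i => ?_⟩
  simpa only [Function.comp_apply, he.extend_apply] using hb x hx (e i)

theorem summable_rpow_of_abs_le {ι : Type*} (hp : 0 ≤ p) {a b : ι → ℝ} (c : ℝ)
    (hb : Summable fun i => |b i| ^ p) (h : ∀ i, |a i| ≤ c * |b i|) :
    Summable fun i => |a i| ^ p := by
  refine (hb.mul_left (|c| ^ p)).of_nonneg_of_le (fun i => by positivity) fun i => ?_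
  rw [← Real.mul_rpow (abs_nonneg _) (abs_nonneg _)]
  refine Real.rpow_le_rpow (abs_nonneg _) ((h i).trans ?_) hp
  gcongr
  exact le_abs_self c

/-- The set of differences of a `p`-limited set is `p`-limited. -/
theorem IsPLimited.sub_image (hp : 0 < p) (hA : IsPLimited 𝕜 p A) :
    IsPLimited 𝕜 p {z | ∃ x ∈ A, ∃ y ∈ A, z = x - y} := by
  intro f hf
  obtain ⟨a, ha, hb⟩ := hA f hf
  refine ⟨fun n => 2 * a n, summable_rpow_of_abs_le hp.le 2 ha fun n => ?_, ?_⟩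
  · simp [abs_mul]
  · rintro _ ⟨x, hx, y, hy, rfl⟩ n
    rw [map_sub]
    have := norm_sub_le (f n x) (f n y)
    linarith [hb x hx n, hb y hy n]

theorem norm_smul_rpow_inv {t : ℝ} (ht : 0 ≤ t) (hp : 0 < p) (f : StrongDual 𝕜 Z) (x : Z) :
    ‖(((t ^ p⁻¹ : ℝ) : 𝕜) • f) x‖ ^ p = t * ‖f x‖ ^ p := by
  rw [smul_apply, norm_smul, RCLike.norm_ofReal, abs_of_nonneg (by positivity),
    Real.mul_rpow (by positivity) (norm_nonneg _), Real.rpow_inv_rpow ht hp.ne']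

/-- Without a uniform constant, choose for each `m` a finite block with sum above `4 ^ m`. Weighted
by `2⁻¹ ^ m` and concatenated, the blocks stay weak* `p`-summable, yet any bounding sequence has
mass at least `2 ^ m` on block `m`. -/
theorem IsPLimited.exists_forall_fin_sum_le (hp : 0 < p) (hA : IsPLimited 𝕜 p A) :
    ∃ C > 0, ∀ (n : ℕ) (f : Fin n → StrongDual 𝕜 Z) (z : Fin n → Z), (∀ i, z i ∈ A) →
      (∀ x, ‖x‖ ≤ 1 → ∑ i, ‖f i x‖ ^ p ≤ 1) → ∑ i, ‖f i (z i)‖ ^ p ≤ C := by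
  by_contra! H
  choose n f z hz hf hlt using fun m : ℕ => H (4 ^ m) (by positivity)
  have hball : ∀ x : Z, ‖x‖ ≤ 1 → Summable fun q : Σ m, Fin (n m) =>
      ‖((((2⁻¹ ^ q.1 : ℝ) ^ p⁻¹ : ℝ) : 𝕜) • f q.1 q.2) x‖ ^ p := by
    intro x hx
    rw [summable_sigma_of_nonneg (fun q => by positivity)]
    refine ⟨fun m => Summable.of_finite, ?_⟩
    refine Summable.of_nonneg_of_le (fun m => tsum_nonneg fun i => by positivity) (fun m => ?_)
      (summable_geometric_of_lt_one (r := 2⁻¹) (by norm_num) (by norm_num))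
    simp only [norm_smul_rpow_inv (show (0 : ℝ) ≤ 2⁻¹ ^ m by positivity) hp]
    rw [tsum_fintype, ← Finset.mul_sum]
    exact mul_le_of_le_one_right (by positivity) (hf m x hx)
  obtain ⟨a, ha, hb⟩ := hA.exists_summable_bound hp
    (fun q : Σ m, Fin (n m) => (((2⁻¹ ^ q.1 : ℝ) ^ p⁻¹ : ℝ) : 𝕜) • f q.1 q.2) (fun x => by
      have hx : ‖(((‖x‖ + 1)⁻¹ : ℝ) : 𝕜) • x‖ ≤ 1 := by
        rw [norm_smul, RCLike.norm_ofReal, abs_of_nonneg (by positivity), inv_mul_le_one₀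
          (by positivity)]
        linarith
      refine ((hball _ hx).mul_left ((‖x‖ + 1) ^ p)).congr fun q => ?_
      rw [map_smul, norm_smul, RCLike.norm_ofReal, abs_of_nonneg (by positivity),
        ← Real.mul_rpow (by positivity) (by positivity), mul_inv_cancel_left₀ (by positivity)])
  have hle : ∀ m : ℕ, (2 : ℝ) ^ m ≤ ∑' q, |a q| ^ p := by
    intro m
    have h1 : ∑ i, |a ⟨m, i⟩| ^ p ≤ ∑' q, |a q| ^ p := by
      have := ha.sum_le_tsum (Finset.univ.map (Function.Embedding.sigmaMk m))
        (fun q _ => by positivity)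
      simpa using this
    have h2 : ∑ i, (2⁻¹ : ℝ) ^ m * ‖f m i (z m i)‖ ^ p ≤ ∑ i, |a ⟨m, i⟩| ^ p := by
      refine Finset.sum_le_sum fun i _ => ?_
      rw [← norm_smul_rpow_inv (by positivity) hp]
      exact Real.rpow_le_rpow (norm_nonneg _)
        ((hb _ (hz m i) ⟨m, i⟩).trans (le_abs_self _)) hp.le
    rw [← Finset.mul_sum] at h2
    have h3 : (2 : ℝ) ^ m = 2⁻¹ ^ m * 4 ^ m := by rw [← mul_pow]; norm_num
    rw [h3]
    exact ((mul_le_mul_of_nonneg_left (hlt m).le (by positivity)).trans h2).trans h1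
  obtain ⟨m, hm⟩ := pow_unbounded_of_one_lt (∑' q, |a q| ^ p) (one_lt_two (α := ℝ))
  exact absurd (hle m) (not_le.2 hm)

/-- The operator whose adjoint restricts functionals to a `p`-limited set is `p`-summing. -/
theorem IsPLimited.exists_forall_sum_le (hp : 0 < p) (hA : IsPLimited 𝕜 p A) :
    ∃ C > 0, ∀ (ι : Type) [Fintype ι] (f : ι → StrongDual 𝕜 Z) (z : ι → Z) (S : ℝ),
      0 < S → (∀ i, z i ∈ A) → (∀ x, ‖x‖ ≤ 1 → ∑ i, ‖f i x‖ ^ p ≤ S) →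
      ∑ i, ‖f i (z i)‖ ^ p ≤ C * S := by
  obtain ⟨C, hC, h⟩ := hA.exists_forall_fin_sum_le hp
  refine ⟨C, hC, fun ι _ f z S hS hz hf => ?_⟩
  let e := (Fintype.equivFin ι).symm
  have hsc : ∀ y : ι → Z, ∑ i, ‖(((S⁻¹ ^ p⁻¹ : ℝ) : 𝕜) • f (e i)) (y (e i))‖ ^ p =
      S⁻¹ * ∑ i, ‖f i (y i)‖ ^ p := by
    intro y
    simp only [norm_smul_rpow_inv (inv_nonneg.2 hS.le) hp]
    rw [← Finset.mul_sum, e.sum_comp (fun i => ‖f i (y i)‖ ^ p)]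
  have := h _ (fun i => ((S⁻¹ ^ p⁻¹ : ℝ) : 𝕜) • f (e i)) (fun i => z (e i)) (fun i => hz _)
    (fun x hx => by
      rw [hsc fun _ => x, inv_mul_le_one₀ hS]
      exact hf x hx)
  rw [hsc z, inv_mul_le_iff₀ hS] at this
  linarith

/-- A `p`-limited set is bounded. -/
theorem IsPLimited.exists_norm_le (hp : 0 < p) (hA : IsPLimited 𝕜 p A) :
    ∃ R > 0, ∀ z ∈ A, ‖z‖ ≤ R := by
  obtain ⟨C, hC, h⟩ := hA.exists_forall_sum_le hp
  refine ⟨C ^ p⁻¹, by positivity, fun z hz => ?_⟩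
  obtain ⟨g, hg, hgz⟩ := exists_dual_vector'' 𝕜 z
  have := h Unit (fun _ => g) (fun _ => z) 1 one_pos (fun _ => hz) (fun x hx => by
    simp only [Finset.univ_unique, Finset.sum_const, Finset.card_singleton, one_smul]
    refine Real.rpow_le_one (norm_nonneg _) ?_ hp.le
    exact (g.le_of_opNorm_le hg x).trans (by simpa using hx))
  simp only [Finset.univ_unique, Finset.sum_const, Finset.card_singleton, one_smul, hgz,
    RCLike.norm_ofReal, abs_norm, mul_one] at this
  rwa [Real.le_rpow_inv_iff_of_pos (norm_nonneg _) hC.le hp]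

open scoped BoundedContinuousFunction

/-- The `p`-th power of the modulus of a functional as a bounded function on the unit ball. -/
noncomputable def normRpowBCF (hp : 0 < p) (f : StrongDual 𝕜 Z) :
    Metric.closedBall (0 : Z) 1 →ᵇ ℝ :=
  BoundedContinuousFunction.ofNormedAddCommGroup (fun x => ‖f x‖ ^ p)
    (Continuous.rpow_const (by fun_prop) fun _ => Or.inr hp.le) (‖f‖ ^ p) fun x => by
      rw [Real.norm_of_nonneg (by positivity)]
      exact Real.rpow_le_rpow (norm_nonneg _)
        (f.unit_le_opNorm _ (mem_closedBall_zero_iff.1 x.2)) hp.le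

@[simp]
theorem normRpowBCF_apply (hp : 0 < p) (f : StrongDual 𝕜 Z) (x : Metric.closedBall (0 : Z) 1) :
    normRpowBCF hp f x = ‖f x‖ ^ p := rfl

/-- Pietsch domination for `p`-limited sets, with a positive functional in place of a measure. -/
theorem IsPLimited.exists_positive_dominating (hp : 0 < p) (hA : IsPLimited 𝕜 p A)
    (hne : A.Nonempty) :
    ∃ L : (Metric.closedBall (0 : Z) 1 →ᵇ ℝ) →ₗ[ℝ] ℝ, (∀ g, 0 ≤ g → 0 ≤ L g) ∧
      ∀ f : StrongDual 𝕜 Z, ∀ z ∈ A, ‖f z‖ ^ p ≤ L (normRpowBCF hp f) := by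
  obtain ⟨C, hC, hsum⟩ := hA.exists_forall_sum_le hp
  let V := Metric.closedBall (0 : Z) 1 →ᵇ ℝ
  let U : Set V := {g | ∃ ε > 0, ∀ x, ε ≤ g x}
  have hUc : Convex ℝ U := by
    rintro g ⟨ε, hε, hg⟩ h ⟨δ, hδ, hh⟩ a b ha hb hab
    refine ⟨min ε δ, lt_min hε hδ, fun x => ?_⟩
    have h1 := mul_le_mul_of_nonneg_left ((min_le_left ε δ).trans (hg x)) ha
    have h2 := mul_le_mul_of_nonneg_left ((min_le_right ε δ).trans (hh x)) hb
    have h3 : (a • g + b • h) x = a * g x + b * h x := rfl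
    rw [h3]
    calc min ε δ = a * min ε δ + b * min ε δ := by rw [← add_mul, hab, one_mul]
      _ ≤ _ := add_le_add h1 h2
  have hUo : IsOpen U := by
    refine Metric.isOpen_iff.2 ?_
    rintro g ⟨ε, hε, hg⟩
    refine ⟨ε / 2, by positivity, fun h hh => ⟨ε / 2, by positivity, fun x => ?_⟩⟩
    have h1 : |h x - g x| < ε / 2 :=
      (BoundedContinuousFunction.dist_coe_le_dist x).trans_lt (Metric.mem_ball.1 hh)
    have := abs_lt.1 h1
    linarith [hg x]
  -- The summing inequality prevents convex combinations of these functions from being uniformly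
  -- positive; separating them from `U` yields the dominating functional.
  let Q : StrongDual 𝕜 Z → Z → V := fun f z =>
    BoundedContinuousFunction.const _ (‖f z‖ ^ p) - C • normRpowBCF hp f
  have hQapp : ∀ f z x, Q f z x = ‖f z‖ ^ p - C * ‖f x‖ ^ p := fun f z x => rfl
  have hQs : ∀ (t : ℝ), 0 ≤ t → ∀ f z, Q (((t ^ p⁻¹ : ℝ) : 𝕜) • f) z = t • Q f z := by
    intro t ht f z
    ext x
    have hr : (t • Q f z) x = t * Q f z x := rfl
    rw [hr, hQapp, hQapp, norm_smul_rpow_inv ht hp, norm_smul_rpow_inv ht hp]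
    ring
  let T : Set V := {q | ∃ f, ∃ z ∈ A, q = Q f z}
  have hdisj : Disjoint U (convexHull ℝ T) := by
    rw [Set.disjoint_left]
    rintro g ⟨ε, hε, hg⟩ hgT
    obtain ⟨ι, _, w, q, hw0, -, hq, hqg⟩ := mem_convexHull_iff_exists_fintype.1 hgT
    choose f z hz hfz using hq
    -- Convex weights are absorbed into the functionals by homogeneity of degree `p`.
    set F : ι → StrongDual 𝕜 Z := fun i => ((w i ^ p⁻¹ : ℝ) : 𝕜) • f i with hF
    have hgx : ∀ x, g x = ∑ i, ‖F i (z i)‖ ^ p - C * ∑ i, ‖F i x‖ ^ p := by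
      intro x
      rw [← hqg, Finset.mul_sum, ← Finset.sum_sub_distrib, BoundedContinuousFunction.sum_apply]
      refine Finset.sum_congr rfl fun i _ => ?_
      rw [hfz, ← hQs _ (hw0 i), hQapp]
    set R := ∑ i, ‖F i (z i)‖ ^ p with hR
    have hRε : ε ≤ R := by
      have h0 := hg ⟨0, by simp⟩
      rw [hgx] at h0
      have : 0 ≤ C * ∑ i, ‖F i ((⟨0, by simp⟩ : Metric.closedBall (0 : Z) 1) : Z)‖ ^ p := by
        positivity
      linarith
    -- The sums over the ball are at most `(R - ε) / C`; keeping only half of `ε` makes the bound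
    -- strictly positive even when `R = ε`.
    have := hsum ι F z ((R - ε / 2) / C) (div_pos (by linarith) hC) hz (fun x hx => by
      have h0 := hg ⟨x, by simpa using hx⟩
      rw [hgx] at h0
      rw [le_div_iff₀ hC]
      simp only at h0
      linarith)
    rw [mul_div_cancel₀ _ hC.ne'] at this
    linarith
  obtain ⟨Φ, u, hΦU, hΦT⟩ := geometric_hahn_banach_open hUc hUo (convex_convexHull ℝ T) hdisj
  have hTu : ∀ f, ∀ z ∈ A, u ≤ Φ (Q f z) := fun f z hz =>
    hΦT _ (subset_convexHull ℝ T ⟨f, z, hz, rfl⟩)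
  have hu : u ≤ 0 := by
    obtain ⟨z, hz⟩ := hne
    have h1 := hTu (((0 ^ p⁻¹ : ℝ) : 𝕜) • 0) z hz
    rw [hQs 0 le_rfl] at h1
    simpa using h1
  -- `T` is stable under nonnegative scaling, so a negative value could be scaled to `u - 1`.
  have hQnn : ∀ f, ∀ z ∈ A, 0 ≤ Φ (Q f z) := by
    intro f z hz
    by_contra! hneg
    have h1 := hTu (((((u - 1) / Φ (Q f z)) ^ p⁻¹ : ℝ) : 𝕜) • f) z hz
    rw [hQs _ (div_nonneg_of_nonpos (by linarith) hneg.le), map_smul, smul_eq_mul,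
      div_mul_cancel₀ _ hneg.ne] at h1
    linarith
  let one : V := BoundedContinuousFunction.const _ 1
  have hone : Φ one < 0 := (hΦU one ⟨1, one_pos, fun x => le_rfl⟩).trans_le hu
  -- If `Φ g > 0`, the added multiple of `one` gives a member of `U` where `Φ` vanishes, although `Φ
  -- < u ≤ 0` on `U`.
  have hΦnn : ∀ g : V, 0 ≤ g → Φ g ≤ 0 := by
    intro g hg
    by_contra! hpos
    have h1 := hΦU (g + (Φ g / (-Φ one)) • one) ⟨Φ g / (-Φ one), div_pos hpos (by linarith),
      fun x => by
        have : (g + (Φ g / (-Φ one)) • one) x = g x + Φ g / (-Φ one) * 1 := rfl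
        rw [this]
        have : 0 ≤ g x := hg x
        linarith⟩
    rw [map_add, map_smul, smul_eq_mul, div_neg, neg_mul, div_mul_cancel₀ _ hone.ne] at h1
    linarith
  refine ⟨(C / Φ one) • (Φ : V →ₗ[ℝ] ℝ), fun g hg => ?_, fun f z hz => ?_⟩
  · exact mul_nonneg_of_nonpos_of_nonpos (div_nonpos_of_nonneg_of_nonpos hC.le hone.le) (hΦnn g hg)
  · have h1 := hQnn f z hz
    have h2 : Q f z = (‖f z‖ ^ p) • one - C • normRpowBCF hp f := by
      ext x
      change ‖f z‖ ^ p - _ = ‖f z‖ ^ p * 1 - _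
      rw [mul_one]
    rw [h2, map_sub, map_smul, map_smul, smul_eq_mul, smul_eq_mul] at h1
    change _ ≤ C / Φ one * Φ (normRpowBCF hp f)
    rw [div_mul_eq_mul_div, le_div_iff_of_neg hone]
    linarith

end PLimited

/-! ### Weakly Cauchy subsequences in `p`-limited sets. -/

section WeaklyCauchy

open scoped BoundedContinuousFunction ComplexConjugate

variable {𝕜 Z : Type*} [RCLike 𝕜] [NormedAddCommGroup Z] [NormedSpace 𝕜 Z] {p : ℝ} {A : Set Z}

/-- The real inner product of two functionals as a bounded function on the unit ball. -/
noncomputable def reInnerBCF (f g : StrongDual 𝕜 Z) : Metric.closedBall (0 : Z) 1 →ᵇ ℝ :=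
  BoundedContinuousFunction.ofNormedAddCommGroup (fun x => RCLike.re (conj (f x) * g x))
    (RCLike.continuous_re.comp ((RCLike.continuous_conj.comp (f.continuous.comp
      continuous_subtype_val)).mul (g.continuous.comp continuous_subtype_val))) (‖f‖ * ‖g‖) fun x => by
      have hx : ‖(x : Z)‖ ≤ 1 := mem_closedBall_zero_iff.1 x.2
      refine (RCLike.norm_re_le_norm _).trans ?_
      rw [norm_mul, RCLike.norm_conj]
      exact mul_le_mul (f.unit_le_opNorm _ hx) (g.unit_le_opNorm _ hx) (norm_nonneg _)
        (norm_nonneg _)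

@[simp]
theorem reInnerBCF_apply (f g : StrongDual 𝕜 Z) (x : Metric.closedBall (0 : Z) 1) :
    reInnerBCF f g x = RCLike.re (conj (f x) * g x) := rfl

theorem reInnerBCF_self (f : StrongDual 𝕜 Z) : reInnerBCF f f = normRpowBCF two_pos f := by
  ext x
  rw [reInnerBCF_apply, normRpowBCF_apply, RCLike.conj_mul, Real.rpow_two]
  norm_cast

/-- The semi-inner product on the dual space induced by a positive functional. -/
@[reducible]
noncomputable def dualPreInnerCore (L : (Metric.closedBall (0 : Z) 1 →ᵇ ℝ) →ₗ[ℝ] ℝ)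
    (hL : ∀ g, 0 ≤ g → 0 ≤ L g) : PreInnerProductSpace.Core ℝ (StrongDual 𝕜 Z) where
  inner f g := L (reInnerBCF f g)
  conj_inner_symm f g := by
    rw [conj_trivial]
    congr 1
    ext x
    simp only [reInnerBCF_apply, RCLike.mul_re, RCLike.conj_re, RCLike.conj_im]
    ring
  re_inner_nonneg f := by
    refine hL _ fun x => ?_
    rw [reInnerBCF_self]
    change 0 ≤ ‖f x‖ ^ (2 : ℝ)
    positivity
  add_left f g h := by
    rw [← map_add]
    congr 1
    ext x
    simp [add_mul]
  smul_left f g r := by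
    rw [conj_trivial, ← smul_eq_mul, ← map_smul]
    congr 1
    ext x
    simp [RCLike.smul_re, RCLike.smul_im, mul_add, mul_assoc]

theorem exists_seminorm_eq_sqrt_inner {E : Type*} [AddCommGroup E] [Module ℝ E]
    (c : PreInnerProductSpace.Core ℝ E) : ∃ s : Seminorm ℝ E, ∀ x, s x = √(c.inner x x) := by
  let : SeminormedAddCommGroup E := InnerProductSpace.Core.toSeminormedAddCommGroup (c := c)
  let : InnerProductSpace ℝ E := InnerProductSpace.ofCore c
  exact ⟨normSeminorm ℝ E, fun x => rfl⟩

/-- Once `t ^ p` exceeds `η`, the quadratic term is already at least `1`. -/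
theorem rpow_le_add_mul_sq {t η : ℝ} (hp : 0 < p) (hη : 0 < η) (ht : 0 ≤ t) (ht1 : t ≤ 1) :
    t ^ p ≤ η + (η ^ (2 / p))⁻¹ * t ^ (2 : ℝ) := by
  rcases le_or_gt (t ^ p) η with h | h
  · exact h.trans (le_add_of_nonneg_right (by positivity))
  · have h1 : η ^ (2 / p) ≤ t ^ (2 : ℝ) := by
      calc η ^ (2 / p) ≤ (t ^ p) ^ (2 / p) := Real.rpow_le_rpow hη.le h.le (by positivity)
        _ = t ^ (2 : ℝ) := by rw [← Real.rpow_mul ht, mul_div_cancel₀ _ hp.ne']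
    have h2 : 1 ≤ (η ^ (2 / p))⁻¹ * t ^ (2 : ℝ) := by
      rwa [← div_eq_inv_mul, one_le_div (by positivity)]
    linarith [Real.rpow_le_one ht ht1 hp.le]

/-- Up to a small multiple of the norm, functionals are controlled on a `p`-limited set by a
Hilbertian seminorm. -/
theorem IsPLimited.exists_inner_dominating (hp : 0 < p) (hA : IsPLimited 𝕜 p A)
    (hne : A.Nonempty) :
    ∃ c : PreInnerProductSpace.Core ℝ (StrongDual 𝕜 Z), ∀ δ > 0, ∃ K ≥ 0,
      ∀ f : StrongDual 𝕜 Z, ∀ z ∈ A, ‖f z‖ ≤ K * √(c.inner f f) + δ * ‖f‖ := by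
  obtain ⟨L, hL, hdom⟩ := hA.exists_positive_dominating hp hne
  obtain ⟨R, hR, hAR⟩ := hA.exists_norm_le hp
  refine ⟨dualPreInnerCore L hL, fun δ hδ => ?_⟩
  let one : Metric.closedBall (0 : Z) 1 →ᵇ ℝ := BoundedContinuousFunction.const _ 1
  have hone : 0 ≤ L one := hL _ fun x => zero_le_one
  -- Chosen so that the constant term costs at most half of `δ ^ p`. If `‖g z‖ > δ`, the quadratic
  -- term supplies the other half, so the Hilbertian seminorm is at least `c`, and `R / c` times it
  -- exceeds the trivial bound `R`.
  set η : ℝ := δ ^ p / (2 * (L one + 1)) with hη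
  have hηpos : 0 < η := by positivity
  set κ : ℝ := (η ^ (2 / p))⁻¹ with hκ
  have hκpos : 0 < κ := by positivity
  have hηL : η * L one ≤ δ ^ p / 2 := by
    rw [hη, div_mul_eq_mul_div, div_le_div_iff₀ (by positivity) two_pos]
    have : 0 < δ ^ p := by positivity
    nlinarith
  set c : ℝ := √(δ ^ p / 2 / κ) with hc
  have hcpos : 0 < c := Real.sqrt_pos.2 (by positivity)
  refine ⟨R / c, by positivity, fun f z hz => ?_⟩
  change _ ≤ R / c * √(L (reInnerBCF f f)) + δ * ‖f‖
  have hunit : ∀ g : StrongDual 𝕜 Z, ‖g‖ ≤ 1 →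
      ‖g z‖ ≤ R / c * √(L (reInnerBCF g g)) + δ := by
    intro g hg
    rcases le_or_gt ‖g z‖ δ with h | h
    · exact h.trans (le_add_of_nonneg_left (by positivity))
    · have h1 : L (normRpowBCF hp g) ≤ L (η • one + κ • normRpowBCF two_pos g) := by
        rw [← sub_nonneg, ← map_sub]
        refine hL _ fun x => ?_
        have hx : ‖(x : Z)‖ ≤ 1 := mem_closedBall_zero_iff.1 x.2
        have := rpow_le_add_mul_sq hp hηpos (norm_nonneg (g x))
          ((g.unit_le_opNorm _ hx).trans hg)
        change 0 ≤ η * 1 + κ * ‖g x‖ ^ (2 : ℝ) - ‖g x‖ ^ p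
        linarith
      have h2 := Real.rpow_le_rpow hδ.le h.le hp.le
      have h3 := hdom g z hz
      rw [map_add, map_smul, map_smul, smul_eq_mul, smul_eq_mul] at h1
      have h4 : c ≤ √(L (reInnerBCF g g)) := by
        rw [reInnerBCF_self]
        refine Real.sqrt_le_sqrt ?_
        rw [div_le_iff₀ hκpos]
        linarith
      have h5 : ‖g z‖ ≤ R := by
        simpa using g.le_of_opNorm_le_of_le hg (hAR z hz)
      have h6 : R ≤ R / c * √(L (reInnerBCF g g)) := by
        rw [div_mul_eq_mul_div, le_div_iff₀ hcpos]
        gcongr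
      linarith
  rcases (norm_nonneg f).eq_or_lt with h | h
  · have : f = 0 := norm_eq_zero.1 h.symm
    rw [this]
    simp only [zero_apply, norm_zero, mul_zero, add_zero]
    positivity
  · have h1 := hunit (((‖f‖⁻¹ : ℝ) : 𝕜) • f) (by
      rw [norm_smul, RCLike.norm_ofReal, abs_of_nonneg (by positivity), inv_mul_cancel₀ h.ne'])
    have h2 : reInnerBCF (((‖f‖⁻¹ : ℝ) : 𝕜) • f) (((‖f‖⁻¹ : ℝ) : 𝕜) • f) =
        (‖f‖⁻¹ ^ 2) • reInnerBCF f f := by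
      rw [reInnerBCF_self, reInnerBCF_self]
      ext x
      change ‖((‖f‖⁻¹ : ℝ) : 𝕜) * f x‖ ^ (2 : ℝ) = ‖f‖⁻¹ ^ 2 * ‖f x‖ ^ (2 : ℝ)
      rw [norm_mul, RCLike.norm_ofReal, abs_of_nonneg (by positivity), Real.rpow_two,
        Real.rpow_two, mul_pow]
    rw [h2, map_smul, smul_eq_mul, Real.sqrt_mul (by positivity), Real.sqrt_sq (by positivity),
      smul_apply, norm_smul, RCLike.norm_ofReal,
      abs_of_nonneg (by positivity)] at h1
    have h3 := mul_le_mul_of_nonneg_left h1 h.le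
    rw [mul_inv_cancel_left₀ h.ne'] at h3
    refine h3.trans (le_of_eq ?_)
    field_simp

/-- Every sequence in a `p`-limited set has a weakly Cauchy subsequence. -/
theorem IsPLimited.exists_subseq_weaklyCauchy (hp : 0 < p) (hA : IsPLimited 𝕜 p A) {z : ℕ → Z}
    (hz : ∀ n, z n ∈ A) :
    ∃ φ : ℕ → ℕ, StrictMono φ ∧ ∀ f : StrongDual 𝕜 Z, CauchySeq fun k => f (z (φ k)) := by
  obtain ⟨c, hc⟩ := hA.exists_inner_dominating hp ⟨_, hz 0⟩
  obtain ⟨s, hs⟩ := exists_seminorm_eq_sqrt_inner c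
  choose K hK hdom using fun j : ℕ => hc (1 / ((j : ℝ) + 1)) (by positivity)
  let l : ℕ → StrongDual 𝕜 Z →ₗ[ℝ] ℝ := fun n =>
    { toFun := fun f => RCLike.re (f (z n))
      map_add' := fun f g => by simp
      map_smul' := fun r f => by simp [RCLike.smul_re] }
  have hsplit : ∀ i : ℕ × ℕ, ∃ u v : StrongDual 𝕜 Z →ₗ[ℝ] ℝ, l i.1 = u + v ∧
      (∀ f, |u f| ≤ K i.2 * √(c.inner f f)) ∧ ∀ f, |v f| ≤ 1 / ((i.2 : ℝ) + 1) * ‖f‖ := by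
    intro i
    let nn (a : ℝ) (ha : 0 ≤ a) : NNReal := ⟨a, ha⟩
    obtain ⟨u, v, h, hu, hv⟩ := exists_add_eq_of_le_seminorm_add (l i.1)
      (nn (K i.2) (hK i.2) • s)
      (nn (1 / ((i.2 : ℝ) + 1)) (by positivity) • normSeminorm ℝ (StrongDual 𝕜 Z))
      (fun f => by
        change RCLike.re (f (z i.1)) ≤ K i.2 * s f + 1 / ((i.2 : ℝ) + 1) * ‖f‖
        rw [hs]
        exact (RCLike.re_le_norm _).trans (hdom i.2 f _ (hz _)))
    exact ⟨u, v, h, fun f => by rw [← hs]; exact hu f, fun f => hv f⟩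
  choose u v huv hu hv using hsplit
  obtain ⟨β, hβ, happ⟩ := exists_seq_approx_of_le_sqrt_inner c u (fun i => K i.2)
    (fun i => hK i.2) hu
  obtain ⟨φ, hφ, hcau⟩ := exists_subseq_cauchySeq_of_approx
    (fun (f : StrongDual 𝕜 Z) n => RCLike.re (f (z n)))
    (fun (i : ℕ × ℕ) n => β i.1 (n, i.2))
    (fun i => by
      obtain ⟨B, hB⟩ := hβ i.1
      exact ⟨K i.2 * B, fun n => hB (n, i.2)⟩)
    (fun f ε hε => by
      obtain ⟨j, hj⟩ := exists_nat_one_div_lt (K := ℝ) (show 0 < ε / 2 / (‖f‖ + 1) by positivity)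
      obtain ⟨k, hk⟩ := happ f (ε / 2 / (K j + 1))
        (div_pos (by positivity) (by linarith [hK j]))
      refine ⟨(k, j), fun n => ?_⟩
      have h1 : RCLike.re (f (z n)) = u (n, j) f + v (n, j) f :=
        LinearMap.congr_fun (huv (n, j)) f
      have h2 : K j * (ε / 2 / (K j + 1)) ≤ ε / 2 := by
        have := hK j
        rw [← mul_div_assoc, div_le_iff₀ (by linarith)]
        nlinarith
      have h3 : 1 / ((j : ℝ) + 1) * ‖f‖ ≤ ε / 2 := by
        rw [lt_div_iff₀ (by positivity)] at hj
        have : 0 ≤ 1 / ((j : ℝ) + 1) := by positivity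
        nlinarith [norm_nonneg f]
      rw [h1, add_sub_right_comm]
      refine (abs_add_le _ _).trans ?_
      have h4 := hk (n, j)
      have h5 := hv (n, j) f
      simp only at h4 h5
      linarith)
  refine ⟨φ, hφ, fun f => ?_⟩
  obtain ⟨r, hr⟩ := cauchySeq_tendsto_of_complete (hcau f)
  -- The imaginary part of `f` is the real part of `-I • f`, so the same subsequence handles it.
  obtain ⟨i, hi⟩ := cauchySeq_tendsto_of_complete (hcau ((-RCLike.I : 𝕜) • f))
  have hlim := ((RCLike.continuous_ofReal (K := 𝕜)).tendsto r |>.comp hr).add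
    (((RCLike.continuous_ofReal (K := 𝕜)).tendsto i |>.comp hi).mul_const RCLike.I)
  refine (hlim.congr fun k => ?_).cauchySeq
  have him : RCLike.re (((-RCLike.I : 𝕜) • f) (z (φ k))) = RCLike.im (f (z (φ k))) := by
    simp
  simp only [Function.comp_apply, him]
  exact RCLike.re_add_im _

end WeaklyCauchy

/-! ### `p`-limited sets of operators. -/

section OperatorSpaces

variable {𝕜 X Y : Type*} [RCLike 𝕜] [NormedAddCommGroup X] [NormedSpace 𝕜 X]
  [NormedAddCommGroup Y] [NormedSpace 𝕜 Y] {p : ℝ}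

/-- Selects a near-maximiser where a supremum need not be attained; if the supremum is zero, any
element works. -/
theorem exists_mem_forall_le_two_mul {S : Set ℝ} (hne : S.Nonempty) (hb : BddAbove S)
    (h0 : ∀ s ∈ S, 0 ≤ s) : ∃ s ∈ S, ∀ t ∈ S, t ≤ 2 * s := by
  obtain ⟨s₀, hs₀⟩ := hne
  rcases (h0 s₀ hs₀ |>.trans (le_csSup hb hs₀)).eq_or_lt with h | h
  · exact ⟨s₀, hs₀, fun t ht => by linarith [le_csSup hb ht, h0 s₀ hs₀]⟩
  · obtain ⟨s, hs, hlt⟩ := exists_lt_of_lt_csSup ⟨s₀, hs₀⟩ (half_lt_self h)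
    exact ⟨s, hs, fun t ht => by linarith [le_csSup hb ht]⟩

/-- In a space of `p`-limited operators, a `p`-limited set maps the unit ball into a `p`-limited
set. -/
theorem IsPLimited.operator_image_closedBall (hp : 0 < p) {M : Submodule 𝕜 (X →L[𝕜] Y)}
    (hlim : ∀ T ∈ M, IsPLimitedOperator p T) {A : Set M} (hA : IsPLimited 𝕜 p A) :
    IsPLimited 𝕜 p {y : Y | ∃ T ∈ A, ∃ x : X, ‖x‖ ≤ 1 ∧ y = (T : X →L[𝕜] Y) x} := by
  intro g hg
  rcases A.eq_empty_or_nonempty with rfl | ⟨T₀, hT₀⟩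
  · exact ⟨0, by simp [Real.zero_rpow hp.ne'], by simp⟩
  obtain ⟨R, hR, hAR⟩ := hA.exists_norm_le hp
  have hsup : ∀ n, ∃ x : X, ‖x‖ ≤ 1 ∧ ∃ T₁ ∈ A, ∀ T ∈ A, ∀ x' : X, ‖x'‖ ≤ 1 →
      ‖g n ((T : X →L[𝕜] Y) x')‖ ≤ 2 * ‖g n ((T₁ : X →L[𝕜] Y) x)‖ := by
    intro n
    obtain ⟨_, ⟨T₁, hT₁, x, hx, rfl⟩, hs⟩ := exists_mem_forall_le_two_mul
      (S := {s | ∃ T ∈ A, ∃ x : X, ‖x‖ ≤ 1 ∧ s = ‖g n ((T : X →L[𝕜] Y) x)‖})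
      ⟨_, T₀, hT₀, 0, by simp, rfl⟩
      ⟨‖g n‖ * R, by
        rintro _ ⟨T, hT, x, hx, rfl⟩
        exact (g n).le_of_opNorm_le_of_le le_rfl
          (((T : X →L[𝕜] Y).unit_le_opNorm x hx).trans (hAR T hT))⟩
      (by
        rintro _ ⟨T, -, x, -, rfl⟩
        exact norm_nonneg _)
    exact ⟨x, hx, T₁, hT₁, fun T hT x' hx' => hs _ ⟨T, hT, x', hx', rfl⟩⟩
  choose x hx T₁ hT₁ hle using hsup
  -- The functionals `T ↦ g n (T (x n))` are weak* `p`-summable on `M` because each `T` in `M` is a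
  -- `p`-limited operator.
  obtain ⟨a, ha, hb⟩ := hA
    (fun n => (g n).comp ((ContinuousLinearMap.apply 𝕜 Y (x n)).comp M.subtypeL)) (fun T => by
      obtain ⟨b, hb, hTb⟩ := hlim T T.2 g hg
      refine hb.of_nonneg_of_le (fun n => by positivity) fun n => ?_
      refine Real.rpow_le_rpow (norm_nonneg _) ?_ hp.le
      exact (hTb _ ⟨x n, by simpa using hx n, rfl⟩ n).trans (le_abs_self _))
  refine ⟨fun n => 2 * a n, summable_rpow_of_abs_le hp.le 2 ha fun n => by simp [abs_mul], ?_⟩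
  rintro _ ⟨T, hT, x', hx', rfl⟩ n
  refine (hle n T hT x' hx').trans ?_
  exact mul_le_mul_of_nonneg_left (hb _ (hT₁ n) n) two_pos.le

/-- A weakly null sequence in a relatively compact set converges to zero in norm. -/
theorem WeaklyNull.tendsto_zero_of_isCompact_closure {S : Set Y} (hS : IsCompact (closure S))
    {y : ℕ → Y} (hy : WeaklyNull 𝕜 y) (hyS : ∀ n, y n ∈ S) : Tendsto y atTop (𝓝 0) := by
  refine tendsto_of_subseq_tendsto fun ns hns => ?_
  obtain ⟨l, -, φ, hφ, hl⟩ := hS.tendsto_subseq (x := y ∘ ns) fun n => subset_closure (hyS _)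
  have hl0 : l = 0 := by
    refine (SeparatingDual.eq_zero_iff_forall_dual_eq_zero (R := 𝕜) l).2 fun f => ?_
    exact tendsto_nhds_unique ((f.continuous.tendsto l).comp hl)
      ((hy f).comp (hns.comp hφ.tendsto_atTop))
  exact ⟨φ, hl0 ▸ hl⟩

/-- A weakly null `p`-limited sequence in a space of `p`-limited operators with `p`-lcc evaluations
is norm null if the target space has the weak `p`-GP property. -/
theorem WeaklyNull.tendsto_zero_of_adjointEval_isPLcc (hp : 0 < p) (hY : HasWeakPGP 𝕜 Y p)
    {M : Submodule 𝕜 (X →L[𝕜] Y)} (hlim : ∀ T ∈ M, IsPLimitedOperator p T)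
    (hev : ∀ y : StrongDual 𝕜 Y, IsPLcc p (adjointEval M y)) {S : ℕ → M}
    (hS : IsPLimited 𝕜 p (Set.range S)) (hw : WeaklyNull 𝕜 S) : Tendsto S atTop (𝓝 0) := by
  have hx : ∀ n, ∃ x : X, ‖x‖ ≤ 1 ∧ ‖S n‖ ≤ 2 * ‖(S n : X →L[𝕜] Y) x‖ := by
    intro n
    rcases (norm_nonneg (S n)).eq_or_lt with h | h
    · exact ⟨0, by simp, by simp [← h]⟩
    · obtain ⟨x, hx, hlt⟩ := (S n : X →L[𝕜] Y).exists_lt_apply_of_lt_opNorm (half_lt_self h)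
      exact ⟨x, hx.le, ((div_lt_iff₀' two_pos).1 hlt).le⟩
  choose x hx hle using hx
  -- `|f (S n (x n))|` is at most the norm of `f ∘ S n`, which tends to zero by the p-lcc
  -- hypothesis.
  have hnull : WeaklyNull 𝕜 fun n => (S n : X →L[𝕜] Y) (x n) := fun f =>
    squeeze_zero_norm (fun n => ((adjointEval M f (S n)).unit_le_opNorm (x n) (hx n)))
      (hev f S hS hw)
  have h0 := hnull.tendsto_zero_of_isCompact_closure
    (hY _ (hS.operator_image_closedBall hp hlim))
    fun n => ⟨S n, ⟨n, rfl⟩, x n, hx n, rfl⟩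
  refine squeeze_zero_norm hle ?_
  simpa using h0.norm.const_mul 2

end OperatorSpaces

/-! ### From weakly Cauchy subsequences to norm compactness. -/

theorem isCompact_closure_of_forall_exists_cauchySeq {E : Type*} [PseudoMetricSpace E]
    [CompleteSpace E] {A : Set E}
    (h : ∀ u : ℕ → E, (∀ n, u n ∈ A) → ∃ φ : ℕ → ℕ, StrictMono φ ∧ CauchySeq (u ∘ φ)) :
    IsCompact (closure A) := by
  refine IsSeqCompact.isCompact fun u hu => ?_
  have hv : ∀ n : ℕ, ∃ v ∈ A, dist (u n) v < 1 / ((n : ℝ) + 1) := fun n =>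
    Metric.mem_closure_iff.1 (hu n) _ (by positivity)
  choose v hvA hv using hv
  obtain ⟨φ, hφ, hc⟩ := h v hvA
  obtain ⟨l, hl⟩ := cauchySeq_tendsto_of_complete hc
  refine ⟨l, mem_closure_of_tendsto hl (Eventually.of_forall fun n => hvA _), φ, hφ, ?_⟩
  have hd : Tendsto (fun n => dist ((v ∘ φ) n) ((u ∘ φ) n)) atTop (𝓝 0) :=
    squeeze_zero (fun n => dist_nonneg) (fun n => by rw [dist_comm]; exact (hv _).le)
      (tendsto_one_div_add_atTop_nhds_zero_nat.comp hφ.tendsto_atTop)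
  exact (tendsto_iff_of_dist hd).1 hl

/-- A weakly Cauchy sequence in a set is norm Cauchy as soon as the weakly null sequences of
differences of its members are norm null. -/
theorem cauchySeq_of_weaklyCauchy {𝕜 Z : Type*} [RCLike 𝕜] [NormedAddCommGroup Z]
    [NormedSpace 𝕜 Z] {A : Set Z} {z : ℕ → Z} (hz : ∀ n, z n ∈ A)
    (hw : ∀ f : StrongDual 𝕜 Z, CauchySeq fun k => f (z k))
    (hnull : ∀ s : ℕ → Z, (∀ n, ∃ x ∈ A, ∃ y ∈ A, s n = x - y) → WeaklyNull 𝕜 s →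
      Tendsto s atTop (𝓝 0)) : CauchySeq z := by
  by_contra hcon
  rw [Metric.cauchySeq_iff] at hcon
  push Not at hcon
  obtain ⟨ε, hε, h⟩ := hcon
  choose m hm n hn hmn using h
  have hmt : Tendsto m atTop atTop := tendsto_atTop_mono hm tendsto_id
  have hnt : Tendsto n atTop atTop := tendsto_atTop_mono hn tendsto_id
  have h0 := hnull (fun k => z (m k) - z (n k))
    (fun k => ⟨_, hz _, _, hz _, rfl⟩) (fun f => by
      obtain ⟨l, hl⟩ := cauchySeq_tendsto_of_complete (hw f)
      simpa using (hl.comp hmt).sub (hl.comp hnt))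
  obtain ⟨k, hk⟩ := ((tendsto_zero_iff_norm_tendsto_zero.1 h0).eventually_lt_const hε).exists
  rw [← dist_eq_norm] at hk
  exact absurd (hmn k) (not_le.2 hk)

theorem theorem2p4 {𝕜 X Y : Type*} [RCLike 𝕜]
    [NormedAddCommGroup X] [NormedSpace 𝕜 X] [CompleteSpace X]
    [NormedAddCommGroup Y] [NormedSpace 𝕜 Y] [CompleteSpace Y]
    (p : ℝ) (hp : 1 ≤ p)
    (hY : HasWeakPGP 𝕜 Y p)
    (M : Submodule 𝕜 (X →L[𝕜] Y)) (hM : IsClosed (M : Set (X →L[𝕜] Y)))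
    (hlim : ∀ T ∈ M, IsPLimitedOperator p T)
    (hev : ∀ y : StrongDual 𝕜 Y, IsPLcc p (adjointEval M y)) :
    HasWeakPGP 𝕜 M p := by
  intro A hA
  have hp0 : 0 < p := one_pos.trans_le hp
  have : CompleteSpace M := hM.completeSpace_coe
  refine isCompact_closure_of_forall_exists_cauchySeq fun T hT => ?_
  obtain ⟨φ, hφ, hw⟩ := hA.exists_subseq_weaklyCauchy hp0 hT
  refine ⟨φ, hφ, cauchySeq_of_weaklyCauchy (fun n => hT _) hw fun S hS hnull => ?_⟩
  refine hnull.tendsto_zero_of_adjointEval_isPLcc hp0 hY hlim hev ((hA.sub_image hp0).mono ?_)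
  rintro _ ⟨n, rfl⟩
  exact hS n
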